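/- **Theorem (Regret reduction from offline expert data).** Consider a Bayesian bandit with a finite non-empty action set $\mathcal A$, a parameter space $\Theta$ (a standard Borel space, e.g. a countable set), an outcome space $\mathcal Y$, outcome distributions $p_{\theta,a}$ on $\mathcal Y$ depending measurably on $\theta$, and a measurable reward function $R:\mathcal Y\to\mathbb R$. Let $\mu(a,\theta)=\mathbb E_{Y\sim p_{\theta,a}}[R(Y)]$ and let $a^*:\Theta\to\mathcal A$ be measurable with $a^*(\theta)\in\arg\max_{a}\mu(a,\theta)$ for all $\theta$. Assume that the mean rewards are bounded, $\sup_{\theta,a}|\mu(a,\theta)|<\infty$, and that the reward noise is uniformly sub-Gaussian: for some $v\ge 0$, $\mathbb E_{Y\sim p_{\theta,a}}[e^{\lambda(R(Y)-\mu(a,\theta))}]\le e^{v\lambda^2/2}$ for all $\lambda\in\mathbb R$, $\theta$, $a$ (both hold, in particular, if $R$ is bounded). Then there is a constant $C$, depending only on this bandit problem (not on the prior, $N$ or $T$), such that the following holds for every prior $P_0$ on $\Theta$ and all $N,T\in\mathbb N$. Let $\theta^*\sim P_0$, $A^*=a^*(\theta^*)$, and, given $\theta^*$, let the expert data $D_N^*=(Y_1^*,\dots,Y_N^*)$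 be i.i.d. from $p_{\theta^*,a^*(\theta^*)}$. Let the learner run Thompson Sampling with the prior replaced by the posterior $P_1(\theta)=P(\theta\mid D_N^*)$: in each round $t$, given the past, it samples $\hat\theta_t$, independently of $\theta^*$, from the posterior of $\theta^*$ given $D_N^*$ and its own history $\mathcal H_t=(A_s,Y_s)_{s<t}$, plays $A_t=a^*(\hat\theta_t)$ and observes $Y_t\sim p_{\theta^*,A_t}$. Let $\mathrm{Reg}(T)=\sum_{t=1}^T \big(R(\bar Y_t)-R(Y_t)\big)$, where $\bar Y_t$, given $\theta^*$, has law $p_{\theta^*,a^*(\theta^*)}$. Then $\mathrm{Reg}(T)$ is integrable and its expectation, over all sources of randomness including $D_N^*$, satisfies $$\mathbb E[\mathrm{Reg}(T)]\le C\sqrt{T\,\big(\mathbb H_0(A^*)-\mathbb I_0(A^*;D_N^*)\big)},$$ where $\mathbb H_0(A^*)=-\sum_{a}P(A^*=a)\log P(A^*=a)$ is the prior entropy of the optimal action, $\mathbb I_0(A^*;D_N^*)=\mathbb H_0(A^*)-\mathbb H_0(A^*\mid D_N^*)$ is the mutual information between the optimal action and the expert data, and $\mathbb H_0(A^*\mid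 D_N^*)=\mathbb E[-\log P(A^*\mid D_N^*)]$. Moreover $0\le \mathbb I_0(A^*;D_N^*)\le\mathbb H_0(A^*)$, so that this bound is never larger than $C\sqrt{T\,\mathbb H_0(A^*)}$. -/

import Mathlib

open MeasureTheory ProbabilityTheory
open scoped NNReal

noncomputable section

/-! ### Information-theoretic quantities (natural logarithm) -/

/-- Shannon entropy `H(X) = -∑ₓ p(x) log p(x)` of a random variable with finitely many values. -/
def entropy {Ω S : Type*} [MeasurableSpace Ω] [Fintype S] (X : Ω → S) (P : Measure Ω) : ℝ :=
  -∑ x : S, P.real (X ⁻¹' {x}) * Real.log (P.real (X ⁻¹' {x}))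

/-- Conditional entropy `H(X | Z) = E[-log p(X | Z)]`, where `p(x | z)` is the conditional
probability of `X = x` given `Z = z`. -/
def condEntropy {Ω S 𝓩 : Type*} [MeasurableSpace Ω] [Fintype S] [Nonempty S]
    [MeasurableSpace S] [DiscreteMeasurableSpace S] [MeasurableSpace 𝓩]
    (X : Ω → S) (Z : Ω → 𝓩) (P : Measure Ω) [IsFiniteMeasure P] : ℝ :=
  ∫ ω, -Real.log ((condDistrib X Z P (Z ω)).real {X ω}) ∂P

/-- Mutual information `I(X; Z) = H(X) - H(X | Z)`. -/
def mutualInfo {Ω S 𝓩 : Type*} [MeasurableSpace Ω] [Fintype S] [Nonempty S]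
    [MeasurableSpace S] [DiscreteMeasurableSpace S] [MeasurableSpace 𝓩]
    (X : Ω → S) (Z : Ω → 𝓩) (P : Measure Ω) [IsFiniteMeasure P] : ℝ :=
  entropy X P - condEntropy X Z P

/-! ### Bandits -/

section Bandit

variable {Θ 𝓐 𝓨 : Type*} [MeasurableSpace Θ] [MeasurableSpace 𝓐] [MeasurableSpace 𝓨]

/-- The mean reward `μ(a, θ) = E_{Y ∼ p_{θ,a}}[R(Y)]`. -/
def meanReward (p : Kernel (Θ × 𝓐) 𝓨) (R : 𝓨 → ℝ) (a : 𝓐) (θ : Θ) : ℝ :=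
  ∫ y, R y ∂(p (θ, a))

/-- The outcome distribution `p_{θ, a*(θ)}` of the optimal action, as a kernel in `θ`. -/
def optKernel (p : Kernel (Θ × 𝓐) 𝓨) (aStar : Θ → 𝓐) (hA : Measurable aStar) : Kernel Θ 𝓨 :=
  p.comap (fun θ => (θ, aStar θ)) (measurable_id.prodMk hA)

instance (p : Kernel (Θ × 𝓐) 𝓨) [IsMarkovKernel p] (aStar : Θ → 𝓐) (hA : Measurable aStar) :
    IsMarkovKernel (optKernel p aStar hA) := by
  unfold optKernel; infer_instance

/-- The law of `N` independent draws from `κ θ`, as a kernel in `θ`. -/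
def iidKernel (κ : Kernel Θ 𝓨) [IsMarkovKernel κ] (N : ℕ) : Kernel Θ (Fin N → 𝓨) where
  toFun θ := Measure.pi fun _ => κ θ
  measurable' := by
    refine Measurable.measure_of_isPiSystem_of_isProbabilityMeasure generateFrom_pi.symm
      isPiSystem_pi ?_
    rintro _ ⟨s, hs, rfl⟩
    simp only [Measure.pi_pi]
    exact Finset.measurable_prod _ fun i _ => κ.measurable_coe (hs i (Set.mem_univ i))

instance (κ : Kernel Θ 𝓨) [IsMarkovKernel κ] (N : ℕ) : IsMarkovKernel (iidKernel κ N) :=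
  ⟨fun θ => by
    change IsProbabilityMeasure (Measure.pi fun _ : Fin N => κ θ)
    infer_instance⟩

variable {Ω : Type*} [MeasurableSpace Ω]

/-- The history of the action-outcome pairs of the learner in the first `t` rounds
(rounds are numbered from `0`). -/
def history (A : ℕ → Ω → 𝓐) (Y : ℕ → Ω → 𝓨) (t : ℕ) (ω : Ω) : Fin t → 𝓐 × 𝓨 :=
  fun s => (A s ω, Y s ω)

/-- The belief of the learner at round `t`: the posterior distribution of the parameter given the
expert data and the history of the first `t` rounds. For `t = 0` the history is trivial and this
is the expert-updated prior `P(θ | D)`. -/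
def belief [StandardBorelSpace Θ] [Nonempty Θ] {N : ℕ} (P : Measure Ω) [IsFiniteMeasure P]
    (θs : Ω → Θ) (D : Ω → Fin N → 𝓨) (A : ℕ → Ω → 𝓐) (Y : ℕ → Ω → 𝓨) (t : ℕ) :
    Kernel ((Fin N → 𝓨) × (Fin t → 𝓐 × 𝓨)) Θ :=
  condDistrib θs (fun ω => (D ω, history A Y t ω)) P

/-- The current belief as the law of the sampled parameter given the true parameter, the expert data
and the history; it does not depend on the true parameter. -/
def sampleKernel [StandardBorelSpace Θ] [Nonempty Θ] {N : ℕ} (P : Measure Ω) [IsFiniteMeasure P]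
    (θs : Ω → Θ) (D : Ω → Fin N → 𝓨) (A : ℕ → Ω → 𝓐) (Y : ℕ → Ω → 𝓨) (t : ℕ) :
    Kernel (Θ × (Fin N → 𝓨) × (Fin t → 𝓐 × 𝓨)) Θ :=
  (belief P θs D A Y t).comap (fun x => x.2) measurable_snd

/-- The law `p_{θ, a}` of the outcome given the true parameter `θ`, the expert data, the history and
the current action `a`; it does not depend on the expert data and the history. -/
def outcomeKernel (p : Kernel (Θ × 𝓐) 𝓨) (N t : ℕ) :
    Kernel (Θ × (Fin N → 𝓨) × (Fin t → 𝓐 × 𝓨) × 𝓐) 𝓨 :=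
  p.comap (fun x => (x.1, x.2.2.2)) (by fun_prop)

/-- The random variables on `(Ω, P)` describe Thompson sampling, warm-started with `N` expert
outcomes, in the Bayesian bandit with outcome distributions `p` and prior `P₀`:
* `θs` is the true parameter and `D` the expert dataset;
* `θhat t`, `A t`, `Y t` are the parameter sampled by the learner, its action and the outcome it
  observes in round `t`;
* `Ystar t` is an outcome of the optimal action in round `t` (its dependence on the other variables,
  beyond the true parameter, is left open). -/
structure IsExpertThompsonSampling [StandardBorelSpace Θ] [Nonempty Θ]
    (p : Kernel (Θ × 𝓐) 𝓨) [IsMarkovKernel p] (aStar : Θ → 𝓐) (hA : Measurable aStar)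
    (P₀ : Measure Θ) (N : ℕ) (P : Measure Ω) [IsFiniteMeasure P]
    (θs : Ω → Θ) (D : Ω → Fin N → 𝓨) (θhat : ℕ → Ω → Θ) (A : ℕ → Ω → 𝓐)
    (Y Ystar : ℕ → Ω → 𝓨) : Prop where
  /-- The true parameter is drawn from the prior. -/
  param_law : HasLaw θs P₀ P
  /-- Given the parameter, the expert outcomes are i.i.d. with law `p_{θ, a*(θ)}`. -/
  expert_law : HasCondDistrib D θs (iidKernel (optKernel p aStar hA) N) P
  /-- Given the parameter, the expert data and the history, the sampled parameter is drawn from the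
  current belief (which depends on the expert data and the history only). -/
  sample_law : ∀ t, HasCondDistrib (θhat t) (fun ω => (θs ω, D ω, history A Y t ω))
    (sampleKernel P θs D A Y t) P
  /-- The learner plays the action that is optimal for the sampled parameter. -/
  action_eq : ∀ t ω, A t ω = aStar (θhat t ω)
  /-- Given the parameter, the past and the current action `a`, the outcome has law `p_{θ, a}`. -/
  outcome_law : ∀ t, HasCondDistrib (Y t) (fun ω => (θs ω, D ω, history A Y t ω, A t ω))
    (outcomeKernel p N t) P
  /-- Given the parameter, the optimal outcome has law `p_{θ, a*(θ)}`. -/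
  optimal_law : ∀ t, HasCondDistrib (Ystar t) θs (optKernel p aStar hA) P

/-- The regret `Reg(T) = ∑_t (R(Y_t*) - R(Y_t))` over the first `T` rounds. -/
def regret (R : 𝓨 → ℝ) (Y Ystar : ℕ → Ω → 𝓨) (T : ℕ) (ω : Ω) : ℝ :=
  ∑ t ∈ Finset.range T, (R (Ystar t ω) - R (Y t ω))

end Bandit

end

/-! ### Integrals and conditional distributions -/

section CondDistrib

variable {Ω 𝓧 𝓤 : Type*} [MeasurableSpace Ω] [MeasurableSpace 𝓧] [MeasurableSpace 𝓤]
  {P : Measure Ω} [IsProbabilityMeasure P] {X : Ω → 𝓧} {U : Ω → 𝓤} {κ : Kernel 𝓧 𝓤}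
  [IsMarkovKernel κ]

/-! Regret has to be paid for by information about the optimal action `A*`. Since `H₀ - I₀` is the
conditional entropy of `A*` given the expert data, and the conditional entropy after `T` further
rounds is still nonnegative, the learner can gain at most `H₀ - I₀` in total.

In one round, let `q a` be the posterior probability that `a` is optimal and let the gap `g a` be
the posterior integral over `{A* = a}` of the mean reward of `a` minus its posterior mean. Thompson
sampling plays `a` with probability `q a`, independently of the parameter given the past, so the
expected regret of the round is the expectation of `∑ g a` (`integral_regret_eq`).

The information gain is bounded below without a chain rule or divergences. By Gibbs' inequality
(`integral_log_le`), any trial conditional law bounds the new conditional entropy from above, and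
this law need only be subnormalised on average. The trial law is the old posterior of `A*` with an
exponential tilt on the probability of the action just played, linear in the observed reward.
Sub-Gaussianity makes it subnormalised (`lintegral_exp_tiltScore_le`), and with the best slope the
gain is the expectation of `∑ g a ^ 2 / (2 * c)` (`integral_tiltScore`).

Since `g ^ 2 / (2 * c) ≥ η * g - η ^ 2 * c / 2`, each round decreases the entropy by at least `η`
times its regret, up to a quadratic error in `η` (`condEntropy_le_sub_regret`). Summing over the
rounds with one common `η` (`IsExpertThompsonSampling.condEntropy_le`) and then choosing `η` gives
the square root. -/

lemma ProbabilityTheory.HasCondDistrib.lintegral_eq (h : HasCondDistrib U X κ P) {f : 𝓧 × 𝓤 → ENNReal}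
    (hf : Measurable f) :
    ∫⁻ ω, f (X ω, U ω) ∂P = ∫⁻ ω, ∫⁻ u, f (X ω, u) ∂κ (X ω) ∂P := by
  have hX := h.aemeasurable_fst
  rw [← lintegral_map' hf.aemeasurable h.aemeasurable, h.map_eq, Measure.lintegral_compProd hf,
    lintegral_map' (Measurable.lintegral_kernel_prod_right' hf).aemeasurable hX]

lemma ProbabilityTheory.HasCondDistrib.integral_eq (h : HasCondDistrib U X κ P) {f : 𝓧 × 𝓤 → ℝ}
    (hf : Measurable f) (hi : Integrable (fun ω => f (X ω, U ω)) P) :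
    ∫ ω, f (X ω, U ω) ∂P = ∫ ω, ∫ u, f (X ω, u) ∂κ (X ω) ∂P := by
  have hX := h.aemeasurable_fst
  have hi' : Integrable f (P.map X ⊗ₘ κ) := by
    rw [← h.map_eq]
    exact (integrable_map_measure hf.aestronglyMeasurable h.aemeasurable).2 hi
  have := integral_map (μ := P) h.aemeasurable (f := f) hf.aestronglyMeasurable
  rw [← this, h.map_eq, Measure.integral_compProd hi',
    integral_map hX hf.stronglyMeasurable.integral_kernel_prod_right'.aestronglyMeasurable]

/-- Rewards may be unbounded; a uniform bound on conditional first absolute moments is what replaces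
boundedness. -/
lemma ProbabilityTheory.HasCondDistrib.integrable_of_bound (h : HasCondDistrib U X κ P) {f : 𝓧 × 𝓤 → ℝ}
    (hf : Measurable f) (c : ℝ) (hi : ∀ x, Integrable (fun u => f (x, u)) (κ x))
    (hc : ∀ x, ∫ u, ‖f (x, u)‖ ∂κ x ≤ c) :
    Integrable (fun ω => f (X ω, U ω)) P := by
  have hX := h.aemeasurable_fst
  have : IsProbabilityMeasure (P.map X) := Measure.isProbabilityMeasure_map hX
  refine (integrable_map_measure hf.aestronglyMeasurable h.aemeasurable).1 ?_
  rw [h.map_eq, Measure.integrable_compProd_iff hf.aestronglyMeasurable]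
  refine ⟨.of_forall hi, Integrable.of_bound (C := c) ?_ (.of_forall fun x => ?_)⟩
  · exact hf.norm.stronglyMeasurable.integral_kernel_prod_right'.aestronglyMeasurable
  · rw [Real.norm_of_nonneg (integral_nonneg fun _ => norm_nonneg _)]
    exact hc x

end CondDistrib

/-! ### Entropy inequalities -/

section Entropy

variable {Ω S 𝓩 : Type*} [MeasurableSpace Ω] [Fintype S] [MeasurableSpace S]
  [DiscreteMeasurableSpace S] [MeasurableSpace 𝓩]
  {P : Measure Ω} [IsProbabilityMeasure P] {X : Ω → S} {Z : Ω → 𝓩} {κ : Kernel 𝓩 S}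
  [IsMarkovKernel κ]

lemma measurable_prod_of_forall_discrete {β : Type*} [MeasurableSpace β] {f : 𝓩 × S → β}
    (hf : ∀ a, Measurable fun z => f (z, a)) : Measurable f :=
  measurable_from_prod_countable_left hf

lemma ProbabilityTheory.HasCondDistrib.lintegral_eq_sum (h : HasCondDistrib X Z κ P) {f : 𝓩 → S → ENNReal}
    (hf : ∀ a, Measurable fun z => f z a) :
    ∫⁻ ω, f (Z ω) (X ω) ∂P = ∫⁻ ω, ∑ a, f (Z ω) a * κ (Z ω) {a} ∂P := by
  rw [HasCondDistrib.lintegral_eq h (f := fun x => f x.1 x.2) (measurable_prod_of_forall_discrete hf)]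
  simp_rw [lintegral_fintype]

lemma measurable_kernel_real (κ : Kernel 𝓩 S) (a : S) : Measurable fun z => (κ z).real {a} :=
  (κ.measurable_coe (measurableSet_singleton a)).ennreal_toReal

lemma sum_ofReal_measureReal_singleton (μ : Measure S) [IsProbabilityMeasure μ] :
    ∑ a, ENNReal.ofReal (μ.real {a}) = 1 := by
  simp only [ofReal_measureReal (measure_ne_top μ _), sum_measure_singleton, Finset.coe_univ,
    measure_univ]

/-- Given `Z`, the atoms of conditional mass zero carry total mass zero, so the logarithms below are
almost surely taken at positive arguments. -/
lemma ProbabilityTheory.HasCondDistrib.ae_pos (h : HasCondDistrib X Z κ P) :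
    ∀ᵐ ω ∂P, 0 < (κ (Z ω)).real {X ω} := by
  have hm : ∀ a, Measurable fun z => if (κ z).real {a} = 0 then (1 : ENNReal) else 0 := fun a =>
    Measurable.ite (measurable_kernel_real κ a (measurableSet_singleton 0)) measurable_const
      measurable_const
  have key := HasCondDistrib.lintegral_eq_sum h hm
  have h0 : ∀ z, ∑ a, (if (κ z).real {a} = 0 then (1 : ENNReal) else 0) * κ z {a} = 0 := by
    intro z
    refine Finset.sum_eq_zero fun a _ => ?_
    split_ifs with hz
    · rw [measureReal_eq_zero_iff] at hz
      simp [hz]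
    · simp
  simp_rw [h0, lintegral_zero] at key
  have hm' : AEMeasurable (fun ω => if (κ (Z ω)).real {X ω} = 0 then (1 : ENNReal) else 0) P :=
    (measurable_prod_of_forall_discrete
      (f := fun x : 𝓩 × S => if (κ x.1).real {x.2} = 0 then (1 : ENNReal) else 0)
      hm).comp_aemeasurable h.aemeasurable
  filter_upwards [(lintegral_eq_zero_iff' hm').1 key] with ω hω
  refine lt_of_le_of_ne measureReal_nonneg fun h0 => ?_
  simp [← h0] at hω

/-- Conditionally on `Z` this is a finite sum of terms `|t * log t|` with `0 ≤ t ≤ 1`, each at most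
`1`. -/
lemma ProbabilityTheory.HasCondDistrib.integrable_log (h : HasCondDistrib X Z κ P) :
    Integrable (fun ω => Real.log ((κ (Z ω)).real {X ω})) P := by
  have hm : ∀ a, Measurable fun z => ‖Real.log ((κ z).real {a})‖ₑ := fun a =>
    (Real.measurable_log.comp (measurable_kernel_real κ a)).enorm
  refine ⟨?_, ?_⟩
  · exact ((measurable_prod_of_forall_discrete (f := fun x : 𝓩 × S => Real.log ((κ x.1).real {x.2}))
      fun a => Real.measurable_log.comp (measurable_kernel_real κ a)).comp_aemeasurable
        h.aemeasurable).aestronglyMeasurable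
  · rw [HasFiniteIntegral, HasCondDistrib.lintegral_eq_sum h hm]
    have hb : ∀ z, ∑ a, ‖Real.log ((κ z).real {a})‖ₑ * κ z {a} ≤ ∑ _a : S, (1 : ENNReal) := by
      intro z
      refine Finset.sum_le_sum fun a _ => ?_
      have h1 : (κ z).real {a} ≤ 1 := measureReal_le_one
      have h0 : 0 ≤ (κ z).real {a} := measureReal_nonneg
      rw [← ofReal_measureReal (μ := κ z) (s := {a}), ← ofReal_norm, Real.norm_eq_abs,
        ← ENNReal.ofReal_mul (abs_nonneg _)]
      refine ENNReal.ofReal_le_one.2 ?_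
      rcases h0.eq_or_lt with h0 | h0
      · simp [← h0]
      · have := (Real.abs_log_mul_self_lt _ h0 h1).le
        rwa [abs_mul, abs_of_pos h0] at this
    refine (lintegral_mono fun ω => hb (Z ω)).trans_lt ?_
    simp

/-- **Gibbs' inequality** for conditional distributions. -/
lemma ProbabilityTheory.HasCondDistrib.integral_log_le (h : HasCondDistrib X Z κ P) {r : 𝓩 → S → ℝ}
    (hr : ∀ a, Measurable fun z => r z a) (hr0 : ∀ z a, 0 ≤ r z a)
    (hpos : ∀ᵐ ω ∂P, 0 < r (Z ω) (X ω))
    (hlog : Integrable (fun ω => Real.log (r (Z ω) (X ω))) P)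
    (hsum : ∑ a, ∫⁻ ω, ENNReal.ofReal (r (Z ω) a) ∂P ≤ 1) :
    ∫ ω, Real.log (r (Z ω) (X ω)) ∂P ≤ ∫ ω, Real.log ((κ (Z ω)).real {X ω}) ∂P := by
  have hZ := h.aemeasurable_fst
  have hq : ∀ a, Measurable fun z => r z a / (κ z).real {a} := fun a =>
    (hr a).div (measurable_kernel_real κ a)
  -- Averaging the likelihood ratio over `X` given `Z` cancels the denominator and leaves the total
  -- mass of `r`.
  have hratio : ∫⁻ ω, ENNReal.ofReal (r (Z ω) (X ω) / (κ (Z ω)).real {X ω}) ∂P ≤ 1 := by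
    rw [HasCondDistrib.lintegral_eq_sum h (f := fun z a => ENNReal.ofReal (r z a / (κ z).real {a}))
      (fun a => (hq a).ennreal_ofReal)]
    refine le_trans ?_ hsum
    have hm : ∀ a ∈ Finset.univ, AEMeasurable (fun ω => ENNReal.ofReal (r (Z ω) a)) P :=
      fun a _ => (hr a).ennreal_ofReal.comp_aemeasurable hZ
    rw [← lintegral_finsetSum' _ hm]
    refine lintegral_mono fun ω => Finset.sum_le_sum fun a _ => ?_
    rw [← ofReal_measureReal (μ := κ (Z ω)) (s := {a}),
      ← ENNReal.ofReal_mul (div_nonneg (hr0 _ _) measureReal_nonneg)]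
    refine ENNReal.ofReal_le_ofReal ?_
    -- Where `κ` has no mass the quotient is `0` by convention, so the mass of `r` there is lost;
    -- hence an inequality.
    rcases eq_or_ne ((κ (Z ω)).real {a}) 0 with h0 | h0
    · simp [h0, hr0]
    · rw [div_mul_cancel₀ _ h0]
  have hnn : ∀ ω, 0 ≤ r (Z ω) (X ω) / (κ (Z ω)).real {X ω} := fun ω =>
    div_nonneg (hr0 _ _) measureReal_nonneg
  have hmeas : AEStronglyMeasurable (fun ω => r (Z ω) (X ω) / (κ (Z ω)).real {X ω}) P :=
    ((measurable_prod_of_forall_discrete (f := fun x : 𝓩 × S => r x.1 x.2 / (κ x.1).real {x.2})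
      hq).comp_aemeasurable h.aemeasurable).aestronglyMeasurable
  have hint : Integrable (fun ω => r (Z ω) (X ω) / (κ (Z ω)).real {X ω}) P :=
    (lintegral_ofReal_ne_top_iff_integrable hmeas (.of_forall hnn)).1
      (ne_top_of_le_ne_top ENNReal.one_ne_top hratio)
  have hle1 : ∫ ω, r (Z ω) (X ω) / (κ (Z ω)).real {X ω} ∂P ≤ 1 := by
    rw [integral_eq_lintegral_of_nonneg_ae (.of_forall hnn) hmeas]
    exact ENNReal.toReal_le_of_le_ofReal zero_le_one (by simpa using hratio)
  have hκ := HasCondDistrib.integrable_log h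
  have hmain : ∫ ω, (Real.log (r (Z ω) (X ω)) - Real.log ((κ (Z ω)).real {X ω})) ∂P
      ≤ ∫ ω, (r (Z ω) (X ω) / (κ (Z ω)).real {X ω} - 1) ∂P := by
    refine integral_mono_ae (hlog.sub hκ) (hint.sub (integrable_const 1)) ?_
    filter_upwards [hpos, HasCondDistrib.ae_pos h] with ω h1 h2
    rw [← Real.log_div h1.ne' h2.ne']
    exact Real.log_le_sub_one_of_pos (div_pos h1 h2)
  rw [integral_sub hlog hκ, integral_sub hint (integrable_const 1)] at hmain
  simp only [integral_const, probReal_univ, smul_eq_mul, mul_one] at hmain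
  linarith

lemma hasCondDistrib_condDistrib {𝓤 : Type*} [MeasurableSpace 𝓤] [StandardBorelSpace 𝓤]
    [Nonempty 𝓤] {U : Ω → 𝓤} (hZ : AEMeasurable Z P) (hU : AEMeasurable U P) :
    HasCondDistrib U Z (condDistrib U Z P) P :=
  ⟨hZ.prodMk hU, (compProd_map_condDistrib hU).symm⟩

lemma entropy_eq_integral (hX : AEMeasurable X P) :
    entropy X P = -∫ ω, Real.log ((P.map X).real {X ω}) ∂P := by
  have : IsProbabilityMeasure (P.map X) := Measure.isProbabilityMeasure_map hX
  rw [← integral_map (f := fun a => Real.log ((P.map X).real {a})) hX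
    (measurable_of_finite _).aestronglyMeasurable, integral_fintype Integrable.of_finite, entropy]
  simp [map_measureReal_apply_of_aemeasurable hX (measurableSet_singleton _)]

variable [Nonempty S]

/-- Conditional distributions are almost everywhere unique, so any version may be used; below, the
version for `A*` is the pushforward of the belief under `aStar`. -/
lemma ProbabilityTheory.HasCondDistrib.condEntropy_eq (h : HasCondDistrib X Z κ P) :
    condEntropy X Z P = -∫ ω, Real.log ((κ (Z ω)).real {X ω}) ∂P := by
  have hae := condDistrib_ae_eq_of_measure_eq_compProd Z h.aemeasurable_snd h.map_eq
  rw [condEntropy, ← integral_neg]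
  refine integral_congr_ae ?_
  filter_upwards [ae_of_ae_map h.aemeasurable_fst hae] with ω hω
  rw [hω]

lemma condEntropy_nonneg (X : Ω → S) (Z : Ω → 𝓩) (P : Measure Ω) [IsProbabilityMeasure P] :
    0 ≤ condEntropy X Z P :=
  integral_nonneg fun _ => neg_nonneg.2 (Real.log_nonpos measureReal_nonneg measureReal_le_one)

lemma condEntropy_le_entropy (hX : AEMeasurable X P) (hZ : AEMeasurable Z P) :
    condEntropy X Z P ≤ entropy X P := by
  have : IsProbabilityMeasure (P.map X) := Measure.isProbabilityMeasure_map hX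
  have h := hasCondDistrib_condDistrib hZ hX
  rw [HasCondDistrib.condEntropy_eq h, entropy_eq_integral hX, neg_le_neg_iff]
  -- Gibbs' inequality with the marginal law as trial law.
  refine HasCondDistrib.integral_log_le h (r := fun _ a => (P.map X).real {a})
    (fun _ => measurable_const) (fun _ _ => measureReal_nonneg) ?_ ?_ ?_
  · refine ae_of_ae_map (p := fun a => 0 < (P.map X).real {a}) hX ?_
    rw [ae_iff_of_countable]
    intro a ha
    exact ENNReal.toReal_pos ha (measure_ne_top _ _)
  · exact (Integrable.of_finite (μ := P.map X)
      (f := fun a => Real.log ((P.map X).real {a}))).comp_aemeasurable hX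
  · simp only [lintegral_const, measure_univ, mul_one]
    exact (sum_ofReal_measureReal_singleton _).le

/-- Conditional entropy decreases when more is known. -/
lemma condEntropy_le_of_comp {𝓩' : Type*} [MeasurableSpace 𝓩'] {Z' : Ω → 𝓩'} {π : 𝓩' → 𝓩}
    (hX : AEMeasurable X P) (hZ' : AEMeasurable Z' P) (hπ : Measurable π)
    (hZ : ∀ ω, π (Z' ω) = Z ω) :
    condEntropy X Z' P ≤ condEntropy X Z P := by
  have hZm : AEMeasurable Z P := by
    rw [← funext hZ]; exact hπ.comp_aemeasurable hZ'
  have h := hasCondDistrib_condDistrib hZm hX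
  have h' := hasCondDistrib_condDistrib hZ' hX
  rw [HasCondDistrib.condEntropy_eq h, HasCondDistrib.condEntropy_eq h', neg_le_neg_iff]
  -- The conditional law given the coarser `Z` is a valid trial law given the finer `Z'`.
  have := HasCondDistrib.integral_log_le h' (r := fun z a => (condDistrib X Z P (π z)).real {a})
    (fun a => (measurable_kernel_real _ a).comp hπ) (fun _ _ => measureReal_nonneg)
    (by simpa only [hZ] using HasCondDistrib.ae_pos h)
    (by simpa only [hZ] using HasCondDistrib.integrable_log h) ?_
  · simpa only [hZ] using this
  · have hm : ∀ a ∈ Finset.univ,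
        AEMeasurable (fun ω => ENNReal.ofReal ((condDistrib X Z P (π (Z' ω))).real {a})) P :=
      fun a _ => ((measurable_kernel_real _ a).comp hπ).ennreal_ofReal.comp_aemeasurable hZ'
    rw [← lintegral_finsetSum' _ hm]
    simp_rw [sum_ofReal_measureReal_singleton]
    simp

end Entropy

/-! ### One round of Thompson sampling -/

section Round

set_option linter.unusedSectionVars false

variable {Θ 𝓐 𝓨 𝓩 : Type*} [MeasurableSpace Θ] [MeasurableSpace 𝓐] [MeasurableSpace 𝓨]
  [MeasurableSpace 𝓩]

lemma measurable_meanReward {p : Kernel (Θ × 𝓐) 𝓨} [IsMarkovKernel p] {R : 𝓨 → ℝ}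
    (hR : Measurable R) : Measurable fun x : Θ × 𝓐 => meanReward p R x.2 x.1 := by
  have := (hR.stronglyMeasurable.comp_measurable
    (measurable_snd (α := Θ × 𝓐) (β := 𝓨))).integral_kernel_prod_right' (κ := p)
  exact this.measurable

/-- The posterior mean of the reward of the action `a` under the belief `b z`. -/
noncomputable def posteriorMean (p : Kernel (Θ × 𝓐) 𝓨) (R : 𝓨 → ℝ) (b : Kernel 𝓩 Θ) (a : 𝓐)
    (z : 𝓩) : ℝ :=
  ∫ θ, meanReward p R a θ ∂b z

/-- The probability under the belief `b z` that the action `a` is optimal. -/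
noncomputable def actionProb (b : Kernel 𝓩 Θ) (aStar : Θ → 𝓐) (a : 𝓐) (z : 𝓩) : ℝ :=
  (b z).real (aStar ⁻¹' {a})

/-- The contribution of the action `a` to the expected regret under the belief `b z`. -/
noncomputable def actionGap (p : Kernel (Θ × 𝓐) 𝓨) (R : 𝓨 → ℝ) (b : Kernel 𝓩 Θ)
    (aStar : Θ → 𝓐) (a : 𝓐) (z : 𝓩) : ℝ :=
  ∫ θ, (aStar ⁻¹' {a}).indicator (fun θ => meanReward p R a θ - posteriorMean p R b a z) θ ∂b z

/-- The slope of the tilting of the posterior in the direction of the reward of `a`. -/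
noncomputable def tiltSlope (p : Kernel (Θ × 𝓐) 𝓨) (R : 𝓨 → ℝ) (b : Kernel 𝓩 Θ)
    (aStar : Θ → 𝓐) (c : ℝ) (a : 𝓐) (z : 𝓩) : ℝ :=
  actionGap p R b aStar a z / (actionProb b aStar a z * c)

open Classical in
/-- The logarithm of the factor by which the probability that `a'` is optimal is tilted after the
action `a` and the outcome `y`. -/
noncomputable def tiltScore (p : Kernel (Θ × 𝓐) 𝓨) (R : 𝓨 → ℝ) (b : Kernel 𝓩 Θ)
    (aStar : Θ → 𝓐) (c : ℝ) (a' : 𝓐) (z : 𝓩) (a : 𝓐) (y : 𝓨) : ℝ :=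
  if a = a' then
    tiltSlope p R b aStar c a z * (R y - posteriorMean p R b a z)
      - c * tiltSlope p R b aStar c a z ^ 2 / 2
  else 0

variable {p : Kernel (Θ × 𝓐) 𝓨} [IsMarkovKernel p] {R : 𝓨 → ℝ} {b : Kernel 𝓩 Θ}
  [IsMarkovKernel b] {v : ℝ≥0} {B : ℝ} {aStar : Θ → 𝓐}

lemma measurable_meanReward_right (hR : Measurable R) (a : 𝓐) :
    Measurable (meanReward p R a) :=
  (measurable_meanReward hR).comp (measurable_id.prodMk measurable_const)

lemma integrable_meanReward (hR : Measurable R) (hB : ∀ θ a, |meanReward p R a θ| ≤ B) (a : 𝓐)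
    (z : 𝓩) : Integrable (meanReward p R a) (b z) :=
  Integrable.of_bound (measurable_meanReward_right hR a).aestronglyMeasurable B
    (.of_forall fun θ => hB θ a)

lemma measurable_posteriorMean (hR : Measurable R) (a : 𝓐) :
    Measurable (posteriorMean p R b a) := by
  have := ((measurable_meanReward_right (p := p) hR a).stronglyMeasurable.comp_measurable
    (measurable_snd (α := 𝓩) (β := Θ))).integral_kernel_prod_right' (κ := b)
  exact this.measurable

lemma abs_posteriorMean_le (hB : ∀ θ a, |meanReward p R a θ| ≤ B) (a : 𝓐) (z : 𝓩) :
    |posteriorMean p R b a z| ≤ B := by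
  have := norm_integral_le_of_norm_le_const (μ := b z) (f := meanReward p R a) (C := B)
    (.of_forall fun θ => hB θ a)
  simpa [posteriorMean] using this

variable [MeasurableSingletonClass 𝓐]

lemma measurable_actionProb (hA : Measurable aStar) (a : 𝓐) :
    Measurable (actionProb b aStar a) :=
  (b.measurable_coe (hA (measurableSet_singleton a))).ennreal_toReal

lemma measurable_actionGap (hR : Measurable R) (hA : Measurable aStar) (a : 𝓐) :
    Measurable (actionGap p R b aStar a) := by
  have hm : Measurable fun x : 𝓩 × Θ => (aStar ⁻¹' {a}).indicator
      (fun θ => meanReward p R a θ - posteriorMean p R b a x.1) x.2 := by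
    have : Measurable fun x : 𝓩 × Θ => meanReward p R a x.2 - posteriorMean p R b a x.1 :=
      ((measurable_meanReward_right hR a).comp measurable_snd).sub
        ((measurable_posteriorMean hR a).comp measurable_fst)
    exact this.indicator (measurable_snd (hA (measurableSet_singleton a)))
  exact (hm.stronglyMeasurable.integral_kernel_prod_right' (κ := b)).measurable

/-- The factor `actionProb` matters: the gap vanishes with the probability, so the convention `0 / 0
= 0` in `tiltSlope` is harmless and the slope stays bounded. -/
lemma abs_actionGap_le (hA : Measurable aStar) (hB : ∀ θ a, |meanReward p R a θ| ≤ B) (a : 𝓐)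
    (z : 𝓩) : |actionGap p R b aStar a z| ≤ 2 * B * actionProb b aStar a z := by
  have hs := hA (measurableSet_singleton a)
  rw [actionGap, integral_indicator hs, ← Real.norm_eq_abs]
  refine norm_setIntegral_le_of_norm_le_const (measure_lt_top (b z) _) fun θ _ => ?_
  have h1 := abs_le.1 (hB θ a)
  have h2 := abs_le.1 (abs_posteriorMean_le (b := b) hB a z)
  rw [Real.norm_eq_abs, abs_le]
  constructor <;> linarith [h1.1, h1.2, h2.1, h2.2]

lemma actionGap_eq (hR : Measurable R) (hA : Measurable aStar)
    (hB : ∀ θ a, |meanReward p R a θ| ≤ B) (a : 𝓐) (z : 𝓩) :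
    actionGap p R b aStar a z =
      ∫ θ, (aStar ⁻¹' {a}).indicator (meanReward p R a) θ ∂b z
        - actionProb b aStar a z * posteriorMean p R b a z := by
  have hs := hA (measurableSet_singleton a)
  rw [actionGap, integral_indicator hs, integral_indicator hs,
    integral_sub (integrable_meanReward hR hB a z).integrableOn (integrable_const _)]
  simp [actionProb]

lemma measurable_tiltSlope (hR : Measurable R) (hA : Measurable aStar) (c : ℝ) (a : 𝓐) :
    Measurable (tiltSlope p R b aStar c a) :=
  (measurable_actionGap hR hA a).div ((measurable_actionProb hA a).mul_const c)

lemma abs_tiltSlope_le (hA : Measurable aStar) (hB : ∀ θ a, |meanReward p R a θ| ≤ B)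
    {c : ℝ} (hc : 0 < c) (a : 𝓐) (z : 𝓩) : |tiltSlope p R b aStar c a z| ≤ 2 * B / c := by
  have h := abs_actionGap_le (b := b) hA hB a z
  have h0 : 0 ≤ actionProb b aStar a z := measureReal_nonneg
  have hB0 : 0 ≤ B := (abs_nonneg _).trans (abs_posteriorMean_le (b := b) hB a z)
  rcases h0.eq_or_lt with h0 | h0
  · simp only [tiltSlope, ← h0, zero_mul, div_zero, abs_zero]
    positivity
  · rw [tiltSlope, abs_div, abs_of_pos (mul_pos h0 hc), div_le_div_iff₀ (mul_pos h0 hc) hc]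
    nlinarith [mul_le_mul_of_nonneg_right h hc.le]

/-- The slope is the maximiser `l = g / (q * c)` of `l * g - c * l ^ 2 / 2 * q`, with maximum `g ^ 2
/ (2 * c * q)`. The outer `q` is the probability of playing `a`; by probability matching it cancels
the one in the denominator. -/
lemma tiltSlope_gain (hA : Measurable aStar) (hB : ∀ θ a, |meanReward p R a θ| ≤ B)
    {c : ℝ} (hc : 0 < c) (a : 𝓐) (z : 𝓩) :
    actionProb b aStar a z * (tiltSlope p R b aStar c a z * actionGap p R b aStar a z
      - c * tiltSlope p R b aStar c a z ^ 2 / 2 * actionProb b aStar a z)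
      = actionGap p R b aStar a z ^ 2 / (2 * c) := by
  have h := abs_actionGap_le (b := b) hA hB a z
  rcases eq_or_ne (actionProb b aStar a z) 0 with h0 | h0
  · have : actionGap p R b aStar a z = 0 := by
      rw [h0, mul_zero] at h
      exact abs_nonpos_iff.1 h
    simp [h0, this]
  · rw [tiltSlope]
    field_simp
    ring

/-- The rewards of an action are sub-Gaussian under the belief of the learner. -/
lemma lintegral_exp_reward_le (hR : Measurable R)
    (hsub : ∀ θ a, HasSubgaussianMGF (fun y => R y - meanReward p R a θ) v (p (θ, a)))
    (hB : ∀ θ a, |meanReward p R a θ| ≤ B) (a : 𝓐) (z : 𝓩) (l : ℝ) :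
    ∫⁻ θ, ∫⁻ y, ENNReal.ofReal (Real.exp (l * (R y - posteriorMean p R b a z))) ∂p (θ, a) ∂b z
      ≤ ENNReal.ofReal (Real.exp ((v + B ^ 2) * l ^ 2 / 2)) := by
  have hB0 : 0 ≤ B := (abs_nonneg _).trans (abs_posteriorMean_le (b := b) hB a z)
  have hm := measurable_meanReward_right (p := p) hR a
  have hinner : ∀ θ, ∫⁻ y, ENNReal.ofReal (Real.exp (l * (R y - posteriorMean p R b a z)))
      ∂p (θ, a) ≤ ENNReal.ofReal (Real.exp (v * l ^ 2 / 2)) *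
        ENNReal.ofReal (Real.exp (l * (meanReward p R a θ - posteriorMean p R b a z))) := by
    intro θ
    have heq : ∀ y, ENNReal.ofReal (Real.exp (l * (R y - posteriorMean p R b a z))) =
        ENNReal.ofReal (Real.exp (l * (R y - meanReward p R a θ))) *
          ENNReal.ofReal (Real.exp (l * (meanReward p R a θ - posteriorMean p R b a z))) := by
      intro y
      rw [← ENNReal.ofReal_mul (Real.exp_pos _).le, ← Real.exp_add]
      ring_nf
    simp_rw [heq]
    rw [lintegral_mul_const _ (by fun_prop)]
    gcongr
    rw [← ofReal_integral_eq_lintegral_ofReal ((hsub θ a).integrable_exp_mul l)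
      (.of_forall fun _ => (Real.exp_pos _).le)]
    exact ENNReal.ofReal_le_ofReal ((hsub θ a).mgf_le l)
  -- Hoeffding's lemma: under the belief the mean reward lies in `[-B, B]`, whose half-length
  -- squared `B ^ 2` is added to the noise parameter `v`.
  have hoeff := hasSubgaussianMGF_of_mem_Icc (μ := b z) (X := meanReward p R a) (a := -B) (b := B)
    hm.aemeasurable (.of_forall fun θ => abs_le.1 (hB θ a))
  change HasSubgaussianMGF (fun θ => meanReward p R a θ - posteriorMean p R b a z) _ _ at hoeff
  calc _ ≤ ∫⁻ θ, ENNReal.ofReal (Real.exp (v * l ^ 2 / 2)) *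
        ENNReal.ofReal (Real.exp (l * (meanReward p R a θ - posteriorMean p R b a z))) ∂b z :=
        lintegral_mono hinner
    _ ≤ ENNReal.ofReal (Real.exp (v * l ^ 2 / 2)) * ENNReal.ofReal (Real.exp (B ^ 2 * l ^ 2 / 2)) := by
        rw [lintegral_const_mul _ (by fun_prop)]
        gcongr
        rw [← ofReal_integral_eq_lintegral_ofReal (hoeff.integrable_exp_mul l)
          (.of_forall fun _ => (Real.exp_pos _).le)]
        refine ENNReal.ofReal_le_ofReal ((hoeff.mgf_le l).trans (le_of_eq ?_))
        have : ((‖B - -B‖₊ / 2 : ℝ≥0) : ℝ) = B := by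
          simp [abs_of_nonneg hB0, ← two_mul]
        rw [NNReal.coe_pow, this]
    _ = _ := by
        rw [← ENNReal.ofReal_mul (Real.exp_pos _).le, ← Real.exp_add]
        ring_nf

/-- The term `-c * l ^ 2 / 2` of the score absorbs the sub-Gaussian moment bound with parameter `v +
B ^ 2 ≤ c`; when `a ≠ a'` there is no tilt. -/
lemma lintegral_exp_tiltScore_le (hR : Measurable R)
    (hsub : ∀ θ a, HasSubgaussianMGF (fun y => R y - meanReward p R a θ) v (p (θ, a)))
    (hB : ∀ θ a, |meanReward p R a θ| ≤ B) {c : ℝ} (hc : v + B ^ 2 ≤ c) (a' a : 𝓐) (z : 𝓩) :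
    ∫⁻ θ, ∫⁻ y, ENNReal.ofReal (Real.exp (tiltScore p R b aStar c a' z a y)) ∂p (θ, a) ∂b z
      ≤ 1 := by
  unfold tiltScore
  split_ifs with h
  · set l := tiltSlope p R b aStar c a z
    simp_rw [sub_eq_add_neg (l * _), Real.exp_add, ENNReal.ofReal_mul (Real.exp_pos _).le]
    have hm : Measurable fun y => ENNReal.ofReal (Real.exp (l * (R y - posteriorMean p R b a z))) := by
      fun_prop
    simp_rw [lintegral_mul_const _ hm]
    rw [lintegral_mul_const'' _ ?_]
    · refine (mul_le_mul_left (lintegral_exp_reward_le hR hsub hB a z l) _).trans ?_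
      rw [← ENNReal.ofReal_mul (Real.exp_pos _).le, ← Real.exp_add]
      refine ENNReal.ofReal_le_one.2 (Real.exp_le_one_iff.2 ?_)
      nlinarith [mul_le_mul_of_nonneg_right hc (sq_nonneg l)]
    · have := (hm.comp (measurable_snd (α := Θ))).lintegral_kernel_prod_right'
        (κ := p.comap (fun θ => (θ, a)) (by fun_prop))
      exact this.aemeasurable
  · simp

end Round

/-! ### Joint law of parameter, action and outcome in one round. -/

section RoundLaw

set_option linter.unusedSectionVars false

variable {Ω Θ 𝓐 𝓨 𝓩 : Type*} [MeasurableSpace Ω] [MeasurableSpace Θ] [MeasurableSpace 𝓐]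
  [MeasurableSpace 𝓨] [MeasurableSpace 𝓩]
  {p : Kernel (Θ × 𝓐) 𝓨} [IsMarkovKernel p] {R : 𝓨 → ℝ} {b : Kernel 𝓩 Θ}
  [IsMarkovKernel b] {v : ℝ≥0} {B : ℝ} {aStar : Θ → 𝓐}
  {P : Measure Ω} [IsProbabilityMeasure P] {θs : Ω → Θ} {Z : Ω → 𝓩} {A : Ω → 𝓐} {Y : Ω → 𝓨}

lemma integrable_reward
    (hsub : ∀ θ a, HasSubgaussianMGF (fun y => R y - meanReward p R a θ) v (p (θ, a)))
    (θ : Θ) (a : 𝓐) : Integrable R (p (θ, a)) := by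
  refine ((hsub θ a).integrable.add (integrable_const (meanReward p R a θ))).congr
    (.of_forall fun y => ?_)
  simp

lemma integral_norm_reward_le
    (hsub : ∀ θ a, HasSubgaussianMGF (fun y => R y - meanReward p R a θ) v (p (θ, a)))
    (hB : ∀ θ a, |meanReward p R a θ| ≤ B) (θ : Θ) (a : 𝓐) :
    ∫ y, ‖R y‖ ∂p (θ, a) ≤ B + 2 * Real.exp (v / 2) := by
  have h := hsub θ a
  have hi1 := h.integrable_exp_mul 1
  have hi2 := h.integrable_exp_mul (-1)
  have h1 := h.mgf_le 1
  have h2 := h.mgf_le (-1)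
  simp only [mgf] at h1 h2
  calc ∫ y, ‖R y‖ ∂p (θ, a)
      ≤ ∫ y, (B + (Real.exp (1 * (R y - meanReward p R a θ))
          + Real.exp (-1 * (R y - meanReward p R a θ)))) ∂p (θ, a) := by
        refine integral_mono (integrable_reward hsub θ a).norm
          ((integrable_const B).add (hi1.add hi2)) fun y => ?_
        -- With `x` the noise, `|x| ≤ exp x + exp (-x)`, so the moment generating function at `1`
        -- and `-1` suffices.
        have e1 := Real.add_one_le_exp (1 * (R y - meanReward p R a θ))
        have e2 := Real.add_one_le_exp (-1 * (R y - meanReward p R a θ))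
        have p1 := Real.exp_pos (1 * (R y - meanReward p R a θ))
        have p2 := Real.exp_pos (-1 * (R y - meanReward p R a θ))
        have hb := abs_le.1 (hB θ a)
        simp only [Real.norm_eq_abs]
        rw [abs_le]
        constructor <;> linarith [hb.1, hb.2]
    _ = B + (∫ y, Real.exp (1 * (R y - meanReward p R a θ)) ∂p (θ, a)
          + ∫ y, Real.exp (-1 * (R y - meanReward p R a θ)) ∂p (θ, a)) := by
        have e1 := integral_add (integrable_const B) (hi1.add hi2)
        have e2 := integral_add hi1 hi2
        simp only [Pi.add_apply] at e1
        rw [e1, e2]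
        simp
    _ ≤ _ := by
        norm_num at h1 h2 ⊢
        linarith

/-- Given `θs` and `A`, the expected reward is the mean reward, also against a bounded weight. -/
lemma integral_mul_reward {𝓧 : Type*} [MeasurableSpace 𝓧] {X : Ω → 𝓧} {s : 𝓧 → Θ × 𝓐}
    (hs : Measurable s) (hY : HasCondDistrib Y X (p.comap s hs) P) (hR : Measurable R)
    (hsub : ∀ θ a, HasSubgaussianMGF (fun y => R y - meanReward p R a θ) v (p (θ, a)))
    (hB : ∀ θ a, |meanReward p R a θ| ≤ B) {w : 𝓧 → ℝ} (hw : Measurable w) {K : ℝ}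
    (hK : ∀ x, |w x| ≤ K) :
    Integrable (fun ω => w (X ω) * R (Y ω)) P ∧
      ∫ ω, w (X ω) * R (Y ω) ∂P = ∫ ω, w (X ω) * meanReward p R (s (X ω)).2 (s (X ω)).1 ∂P := by
  have hm : Measurable fun x : 𝓧 × 𝓨 => w x.1 * R x.2 := by fun_prop
  have hi : Integrable (fun ω => w (X ω) * R (Y ω)) P := by
    refine HasCondDistrib.integrable_of_bound hY hm (K * (B + 2 * Real.exp (v / 2)))
      (fun x => (integrable_reward hsub (s x).1 (s x).2).const_mul (w x)) fun x => ?_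
    simp only [norm_mul, integral_const_mul]
    exact mul_le_mul (hK x) (integral_norm_reward_le hsub hB _ _)
      (integral_nonneg fun _ => norm_nonneg _) ((abs_nonneg _).trans (hK x))
  refine ⟨hi, ?_⟩
  rw [HasCondDistrib.integral_eq hY hm hi]
  simp only [integral_const_mul]
  rfl

variable [Fintype 𝓐] [DiscreteMeasurableSpace 𝓐]

lemma map_real_singleton (hA : Measurable aStar) (z : 𝓩) (a : 𝓐) :
    (b.map aStar z).real {a} = actionProb b aStar a z := by
  rw [Kernel.map_apply _ hA, map_measureReal_apply hA (measurableSet_singleton a)]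
  rfl

/-- Given `Z`, parameter and action are independent. Hence for each fixed `a` the parameter is
averaged over the whole belief, not over the belief conditioned on the action. -/
lemma lintegral_le_of_forall_action (hA : Measurable aStar) (hθ : HasCondDistrib θs Z b P)
    (hact : HasCondDistrib A (fun ω => (θs ω, Z ω))
      (Kernel.prodMkLeft Θ (b.map aStar)) P)
    (hout : HasCondDistrib Y (fun ω => (θs ω, Z ω, A ω))
      (p.comap (fun x : Θ × 𝓩 × 𝓐 => (x.1, x.2.2)) (by fun_prop)) P)
    {F : 𝓩 × 𝓐 × 𝓨 → ENNReal} (hF : Measurable F) {W : 𝓩 → ENNReal}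
    (hW : ∀ z a, ∫⁻ θ, ∫⁻ y, F (z, a, y) ∂p (θ, a) ∂b z ≤ W z) :
    ∫⁻ ω, F (Z ω, A ω, Y ω) ∂P ≤ ∫⁻ ω, W (Z ω) ∂P := by
  have : IsMarkovKernel (b.map aStar) := Kernel.IsMarkovKernel.map _ hA
  have hH : Measurable fun x : Θ × 𝓩 × 𝓐 => ∫⁻ y, F (x.2.1, x.2.2, y) ∂p (x.1, x.2.2) :=
    Measurable.lintegral_kernel_prod_right' (κ := p.comap (fun x : Θ × 𝓩 × 𝓐 => (x.1, x.2.2))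
      (by fun_prop)) (f := fun x : (Θ × 𝓩 × 𝓐) × 𝓨 => F (x.1.2.1, x.1.2.2, x.2)) (by fun_prop)
  have e1 := HasCondDistrib.lintegral_eq hout
    (f := fun x : (Θ × 𝓩 × 𝓐) × 𝓨 => F (x.1.2.1, x.1.2.2, x.2)) (by fun_prop)
  have e2 := HasCondDistrib.lintegral_eq hact
    (f := fun x : (Θ × 𝓩) × 𝓐 => ∫⁻ y, F (x.1.2, x.2, y) ∂p (x.1.1, x.2))
    (hH.comp (by fun_prop : Measurable fun x : (Θ × 𝓩) × 𝓐 => (x.1.1, x.1.2, x.2)))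
  simp only [Kernel.comap_apply, Kernel.prodMkLeft_apply] at e1 e2
  rw [e1, e2]
  simp_rw [lintegral_fintype]
  have hH' : ∀ a, Measurable fun x : 𝓩 × Θ => ∫⁻ y, F (x.1, a, y) ∂p (x.2, a) := fun a =>
    hH.comp (by fun_prop : Measurable fun x : 𝓩 × Θ => (x.2, x.1, a))
  have hq : ∀ a, Measurable fun z => b.map aStar z {a} := fun a =>
    Kernel.measurable_coe _ (measurableSet_singleton a)
  have hm : Measurable fun x : 𝓩 × Θ =>
      ∑ a, (∫⁻ y, F (x.1, a, y) ∂p (x.2, a)) * b.map aStar x.1 {a} :=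
    Finset.measurable_sum _ fun a _ => (hH' a).mul ((hq a).comp measurable_fst)
  rw [HasCondDistrib.lintegral_eq hθ hm]
  refine lintegral_mono fun ω => ?_
  have hH'' : ∀ a, Measurable fun θ => ∫⁻ y, F (Z ω, a, y) ∂p (θ, a) := fun a =>
    (hH' a).comp measurable_prodMk_left
  simp only
  rw [lintegral_finsetSum _ fun a _ => (hH'' a).mul_const _]
  simp_rw [lintegral_mul_const _ (hH'' _)]
  calc _ ≤ ∑ a, W (Z ω) * b.map aStar (Z ω) {a} :=
        Finset.sum_le_sum fun a _ => mul_le_mul_left (hW _ _) _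
    _ = W (Z ω) := by
        rw [← Finset.mul_sum, sum_measure_singleton]
        simp

/-- Independence of action and parameter given `Z` factors the probability of playing `a` out of the
integral over the belief. -/
lemma integral_eq_sum_action (hA : Measurable aStar) (hθ : HasCondDistrib θs Z b P)
    (hact : HasCondDistrib A (fun ω => (θs ω, Z ω))
      (Kernel.prodMkLeft Θ (b.map aStar)) P)
    {G : Θ × 𝓩 × 𝓐 → ℝ} (hG : Measurable G) {K : ℝ} (hK : ∀ x, |G x| ≤ K) :
    ∫ ω, G (θs ω, Z ω, A ω) ∂P =
      ∫ ω, ∑ a, actionProb b aStar a (Z ω) * ∫ θ, G (θ, Z ω, a) ∂b (Z ω) ∂P := by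
  have : IsMarkovKernel (b.map aStar) := Kernel.IsMarkovKernel.map _ hA
  have hm : Measurable fun x : (Θ × 𝓩) × 𝓐 => G (x.1.1, x.1.2, x.2) := by fun_prop
  have hi : Integrable (fun ω => G (θs ω, Z ω, A ω)) P :=
    Integrable.of_bound (hm.comp_aemeasurable hact.aemeasurable).aestronglyMeasurable K
      (.of_forall fun ω => hK _)
  rw [HasCondDistrib.integral_eq hact (f := fun x : (Θ × 𝓩) × 𝓐 => G (x.1.1, x.1.2, x.2)) hm hi]
  simp only [Kernel.prodMkLeft_apply, integral_fintype Integrable.of_finite, map_real_singleton hA,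
    smul_eq_mul]
  have hm2 : Measurable fun x : 𝓩 × Θ => ∑ a, actionProb b aStar a x.1 * G (x.2, x.1, a) := by
    refine Finset.measurable_sum _ fun a _ => ?_
    have := measurable_actionProb (b := b) hA a
    fun_prop
  have hbd : ∀ x : 𝓩 × Θ, ‖∑ a, actionProb b aStar a x.1 * G (x.2, x.1, a)‖ ≤ ∑ _a : 𝓐, K := by
    intro x
    refine norm_sum_le_of_le _ fun a _ => ?_
    have h0 : 0 ≤ actionProb b aStar a x.1 := measureReal_nonneg
    have h1 : actionProb b aStar a x.1 ≤ 1 := measureReal_le_one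
    rw [norm_mul, Real.norm_of_nonneg h0]
    exact (mul_le_of_le_one_left (norm_nonneg _) h1).trans (hK _)
  rw [HasCondDistrib.integral_eq hθ hm2 (Integrable.of_bound
    (hm2.comp_aemeasurable hθ.aemeasurable).aestronglyMeasurable _ (.of_forall fun ω => hbd _))]
  refine integral_congr_ae (.of_forall fun ω => ?_)
  have hG' : ∀ a, Measurable fun θ => G (θ, Z ω, a) := fun a => by fun_prop
  simp only
  rw [integral_finsetSum _ fun a _ => (Integrable.of_bound (hG' a).aestronglyMeasurable K
    (.of_forall fun θ => hK _)).const_mul _]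
  simp_rw [integral_const_mul]

end RoundLaw

/-! ### Regret and information gain of one round. -/

section RoundBound

set_option linter.unusedSectionVars false

variable {Ω Θ 𝓐 𝓨 𝓩 : Type*} [MeasurableSpace Ω] [MeasurableSpace Θ] [MeasurableSpace 𝓐]
  [MeasurableSpace 𝓨] [MeasurableSpace 𝓩]
  {p : Kernel (Θ × 𝓐) 𝓨} [IsMarkovKernel p] {R : 𝓨 → ℝ} {b : Kernel 𝓩 Θ}
  [IsMarkovKernel b] {v : ℝ≥0} {B : ℝ} {aStar : Θ → 𝓐}
  {P : Measure Ω} [IsProbabilityMeasure P] {θs : Ω → Θ} {Z : Ω → 𝓩} {A : Ω → 𝓐} {Y Ystar : Ω → 𝓨}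
  [Fintype 𝓐] [DiscreteMeasurableSpace 𝓐]

lemma abs_actionGap_le_const (hA : Measurable aStar) (hB : ∀ θ a, |meanReward p R a θ| ≤ B)
    (a : 𝓐) (z : 𝓩) : |actionGap p R b aStar a z| ≤ 2 * B := by
  have hB0 : 0 ≤ B := (abs_nonneg _).trans (abs_posteriorMean_le (b := b) hB a z)
  have h1 : actionProb b aStar a z ≤ 1 := measureReal_le_one
  exact (abs_actionGap_le hA hB a z).trans (mul_le_of_le_one_right (by positivity) h1)

lemma integrable_actionGap_pow (hR : Measurable R) (hA : Measurable aStar)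
    (hB : ∀ θ a, |meanReward p R a θ| ≤ B) (hZ : AEMeasurable Z P) (a : 𝓐) (n : ℕ) :
    Integrable (fun ω => actionGap p R b aStar a (Z ω) ^ n) P := by
  refine Integrable.of_bound (((measurable_actionGap hR hA a).pow_const n).comp_aemeasurable
    hZ).aestronglyMeasurable ((2 * B) ^ n) (.of_forall fun ω => ?_)
  rw [norm_pow]
  exact pow_le_pow_left₀ (norm_nonneg _) (abs_actionGap_le_const hA hB a _) n

lemma integral_optimal_reward (hA : Measurable aStar) (hR : Measurable R)
    (hsub : ∀ θ a, HasSubgaussianMGF (fun y => R y - meanReward p R a θ) v (p (θ, a)))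
    (hB : ∀ θ a, |meanReward p R a θ| ≤ B) (hθ : HasCondDistrib θs Z b P)
    (hstar : HasCondDistrib Ystar θs (optKernel p aStar hA) P) :
    Integrable (fun ω => R (Ystar ω)) P ∧ ∫ ω, R (Ystar ω) ∂P =
      ∫ ω, ∑ a, ∫ θ, (aStar ⁻¹' {a}).indicator (meanReward p R a) θ ∂b (Z ω) ∂P := by
  classical
  obtain ⟨hi, he⟩ := integral_mul_reward _ hstar hR hsub hB (w := fun _ => 1) measurable_const
    (K := 1) (by simp)
  simp only [one_mul] at hi he
  refine ⟨hi, ?_⟩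
  have hm : Measurable fun θ => meanReward p R (aStar θ) θ :=
    (measurable_meanReward hR).comp (measurable_id.prodMk hA)
  rw [he, HasCondDistrib.integral_eq hθ (f := fun x => meanReward p R (aStar x.2) x.2)
    (hm.comp measurable_snd) (Integrable.of_bound
      (hm.comp_aemeasurable hθ.aemeasurable_snd).aestronglyMeasurable B (.of_forall fun _ => hB _ _))]
  refine integral_congr_ae (.of_forall fun ω => ?_)
  simp only
  rw [← integral_finsetSum _ fun a _ => (integrable_meanReward hR hB a (Z ω)).indicator
    (hA (measurableSet_singleton a))]
  refine integral_congr_ae (.of_forall fun θ => ?_)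
  simp [Set.indicator_apply]

/-- The expected regret of a round is the expected sum of the gaps. -/
lemma integral_regret_eq (hA : Measurable aStar) (hR : Measurable R)
    (hsub : ∀ θ a, HasSubgaussianMGF (fun y => R y - meanReward p R a θ) v (p (θ, a)))
    (hB : ∀ θ a, |meanReward p R a θ| ≤ B) (hθ : HasCondDistrib θs Z b P)
    (hact : HasCondDistrib A (fun ω => (θs ω, Z ω)) (Kernel.prodMkLeft Θ (b.map aStar)) P)
    (hout : HasCondDistrib Y (fun ω => (θs ω, Z ω, A ω))
      (p.comap (fun x : Θ × 𝓩 × 𝓐 => (x.1, x.2.2)) (by fun_prop)) P)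
    (hstar : HasCondDistrib Ystar θs (optKernel p aStar hA) P) :
    Integrable (fun ω => R (Ystar ω) - R (Y ω)) P ∧
      ∫ ω, (R (Ystar ω) - R (Y ω)) ∂P = ∫ ω, ∑ a, actionGap p R b aStar a (Z ω) ∂P := by
  obtain ⟨hi1, he1⟩ := integral_optimal_reward hA hR hsub hB hθ hstar
  obtain ⟨hi2, he2⟩ := integral_mul_reward _ hout hR hsub hB (w := fun _ => 1) measurable_const
    (K := 1) (by simp)
  simp only [one_mul] at hi2 he2
  refine ⟨hi1.sub hi2, ?_⟩
  have hZ := hθ.aemeasurable_fst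
  have hG := integral_eq_sum_action hA hθ hact (G := fun x => meanReward p R x.2.2 x.1)
    ((measurable_meanReward hR).comp (by fun_prop : Measurable fun x : Θ × 𝓩 × 𝓐 => (x.1, x.2.2)))
    (fun x => hB _ _)
  have hint : Integrable (fun ω => ∑ a, actionProb b aStar a (Z ω) * posteriorMean p R b a (Z ω))
      P := by
    refine integrable_finsetSum _ fun a _ => Integrable.of_bound (C := B)
      (((measurable_actionProb hA a).mul (measurable_posteriorMean hR a)).comp_aemeasurable
        hZ).aestronglyMeasurable (.of_forall fun ω => ?_)
    have h0 : 0 ≤ actionProb b aStar a (Z ω) := measureReal_nonneg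
    have h1 : actionProb b aStar a (Z ω) ≤ 1 := measureReal_le_one
    rw [norm_mul, Real.norm_of_nonneg h0]
    exact (mul_le_of_le_one_left (norm_nonneg _) h1).trans (abs_posteriorMean_le hB _ _)
  have hgap : Integrable (fun ω => ∑ a, actionGap p R b aStar a (Z ω)) P :=
    integrable_finsetSum _ fun a _ => by simpa using integrable_actionGap_pow hR hA hB hZ a 1
  -- The optimal reward splits into the gaps and the reward expected from Thompson sampling; the
  -- latter cancels in the regret.
  have hsplit : ∀ z, ∑ a, ∫ θ, (aStar ⁻¹' {a}).indicator (meanReward p R a) θ ∂b z =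
      ∑ a, actionGap p R b aStar a z +
        ∑ a, actionProb b aStar a z * posteriorMean p R b a z := by
    intro z
    rw [← Finset.sum_add_distrib]
    exact Finset.sum_congr rfl fun a _ => by rw [actionGap_eq hR hA hB]; ring
  rw [integral_sub hi1 hi2, he1, he2, hG]
  simp_rw [hsplit]
  rw [integral_add hgap hint]
  exact add_sub_cancel_right _ _

/-- The score evaluated at the true optimal action is nonzero only if that action is played.
Averaging over the belief then produces the gap, and `tiltSlope_gain` evaluates the quadratic. -/
lemma integral_tiltScore (hA : Measurable aStar) (hR : Measurable R)
    (hsub : ∀ θ a, HasSubgaussianMGF (fun y => R y - meanReward p R a θ) v (p (θ, a)))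
    (hB : ∀ θ a, |meanReward p R a θ| ≤ B) (hθ : HasCondDistrib θs Z b P)
    (hact : HasCondDistrib A (fun ω => (θs ω, Z ω)) (Kernel.prodMkLeft Θ (b.map aStar)) P)
    (hout : HasCondDistrib Y (fun ω => (θs ω, Z ω, A ω))
      (p.comap (fun x : Θ × 𝓩 × 𝓐 => (x.1, x.2.2)) (by fun_prop)) P) {c : ℝ} (hc : 0 < c) :
    Integrable (fun ω => tiltScore p R b aStar c (aStar (θs ω)) (Z ω) (A ω) (Y ω)) P ∧
      ∫ ω, tiltScore p R b aStar c (aStar (θs ω)) (Z ω) (A ω) (Y ω) ∂P =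
        ∫ ω, ∑ a, actionGap p R b aStar a (Z ω) ^ 2 / (2 * c) ∂P := by
  classical
  set l : 𝓐 → 𝓩 → ℝ := tiltSlope p R b aStar c with hl
  set m : 𝓐 → 𝓩 → ℝ := posteriorMean p R b with hm
  have hlm : ∀ a, Measurable (l a) := fun a => measurable_tiltSlope hR hA c a
  have hmm : ∀ a, Measurable (m a) := fun a => measurable_posteriorMean hR a
  have hlb : ∀ a z, |l a z| ≤ 2 * B / c := fun a z => abs_tiltSlope_le hA hB hc a z
  have hmb : ∀ a z, |m a z| ≤ B := fun a z => abs_posteriorMean_le hB a z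
  have hjoint : ∀ f : 𝓐 → 𝓩 → ℝ, (∀ a, Measurable (f a)) →
      Measurable fun x : Θ × 𝓩 × 𝓐 => f x.2.2 x.2.1 := fun f hf =>
    (measurable_prod_of_forall_discrete (f := fun x : 𝓩 × 𝓐 => f x.2 x.1) hf).comp measurable_snd
  have hset : MeasurableSet {x : Θ × 𝓩 × 𝓐 | x.2.2 = aStar x.1} :=
    measurableSet_eq_fun (by fun_prop) (by fun_prop)
  have hl' := hjoint l hlm
  have hm' := hjoint m hmm
  -- The score is affine in the reward, with bounded coefficients `w` and `e` that do not involve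
  -- the outcome; so the reward can be replaced by its conditional mean.
  let w : Θ × 𝓩 × 𝓐 → ℝ := fun x => if x.2.2 = aStar x.1 then l x.2.2 x.2.1 else 0
  let e : Θ × 𝓩 × 𝓐 → ℝ := fun x => if x.2.2 = aStar x.1 then
    -(l x.2.2 x.2.1 * m x.2.2 x.2.1) - c * l x.2.2 x.2.1 ^ 2 / 2 else 0
  have hw : Measurable w := Measurable.ite hset hl' measurable_const
  have he : Measurable e := Measurable.ite hset
    ((hl'.mul hm').neg.sub (((hl'.pow_const 2).const_mul c).div_const 2)) measurable_const
  have hB0 : 0 ≤ B := by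
    obtain ⟨ω⟩ : Nonempty Ω := P.nonempty_of_neZero
    exact (abs_nonneg _).trans (hB (θs ω) (A ω))
  have hwb : ∀ x, |w x| ≤ 2 * B / c := by
    intro x
    simp only [w]
    split_ifs
    · exact hlb _ _
    · simp only [abs_zero]; positivity
  have heb : ∀ x, |e x| ≤ 2 * B / c * B + c * (2 * B / c) ^ 2 / 2 := by
    intro x
    simp only [e]
    split_ifs
    · refine (abs_sub _ _).trans ?_
      rw [abs_neg, abs_mul, abs_div, abs_mul, abs_pow, abs_of_pos hc, abs_two]
      have h1 := hlb x.2.2 x.2.1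
      have h2 := hmb x.2.2 x.2.1
      gcongr
    · simp only [abs_zero]; positivity
  obtain ⟨hi1, he1⟩ := integral_mul_reward _ hout hR hsub hB hw hwb
  have hi2 : Integrable (fun ω => e (θs ω, Z ω, A ω)) P :=
    Integrable.of_bound (he.comp_aemeasurable hout.aemeasurable_fst).aestronglyMeasurable _
      (.of_forall fun ω => heb _)
  have hmu : Measurable fun x : Θ × 𝓩 × 𝓐 => meanReward p R x.2.2 x.1 :=
    (measurable_meanReward hR).comp (by fun_prop : Measurable fun x : Θ × 𝓩 × 𝓐 => (x.1, x.2.2))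
  have hi3 : Integrable
      (fun ω => w (θs ω, Z ω, A ω) * meanReward p R (A ω) (θs ω)) P := by
    refine Integrable.of_bound ((hw.mul hmu).comp_aemeasurable
      hout.aemeasurable_fst).aestronglyMeasurable (2 * B / c * B) (.of_forall fun ω => ?_)
    rw [norm_mul]
    exact mul_le_mul (hwb _) (hB _ _) (norm_nonneg _) (by positivity)
  have hscore : (fun ω => tiltScore p R b aStar c (aStar (θs ω)) (Z ω) (A ω) (Y ω)) =
      fun ω => w (θs ω, Z ω, A ω) * R (Y ω) + e (θs ω, Z ω, A ω) := by
    funext ω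
    simp only [tiltScore, w, e]
    split_ifs
    · simp only [hl, hm]; ring
    · ring
  rw [hscore]
  refine ⟨hi1.add hi2, ?_⟩
  rw [integral_add hi1 hi2, he1]
  simp only
  rw [← integral_add hi3 hi2]
  have hG := integral_eq_sum_action hA hθ hact
    (G := fun x => w x * meanReward p R x.2.2 x.1 + e x) ((hw.mul hmu).add he)
    (K := 2 * B / c * B + (2 * B / c * B + c * (2 * B / c) ^ 2 / 2)) (fun x => by
      refine (abs_add_le _ _).trans (add_le_add ?_ (heb x))
      rw [abs_mul]
      exact mul_le_mul (hwb _) (hB _ _) (abs_nonneg _) (by positivity))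
  rw [hG]
  refine integral_congr_ae (.of_forall fun ω => Finset.sum_congr rfl fun a _ => ?_)
  rw [← tiltSlope_gain hA hB hc a (Z ω)]
  congr 1
  have hs := hA (measurableSet_singleton a)
  have hfun : (fun θ => w (θ, Z ω, a) * meanReward p R a θ + e (θ, Z ω, a)) =
      fun θ => l a (Z ω) * (aStar ⁻¹' {a}).indicator
        (fun θ => meanReward p R a θ - m a (Z ω)) θ
        - c * l a (Z ω) ^ 2 / 2 * (aStar ⁻¹' {a}).indicator (fun _ => 1) θ := by
    funext θ
    by_cases h : a = aStar θ
    · simp only [w, e, Set.indicator, if_pos h, Set.mem_preimage, Set.mem_singleton_iff, if_pos h.symm]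
      ring
    · simp [w, e, h, Ne.symm h]
  simp only
  rw [hfun, integral_sub, integral_const_mul, integral_const_mul, integral_indicator_const _ hs]
  · simp [actionGap, actionProb, hl, hm]
  · exact (((integrable_meanReward hR hB a (Z ω)).sub (integrable_const _)).indicator hs).const_mul _
  · exact ((integrable_const _).indicator hs).const_mul _

/-- The information gain about the optimal action in one round bounds the expected regret. -/
lemma condEntropy_le_sub_regret [Nonempty 𝓐] {𝓩' : Type*} [MeasurableSpace 𝓩'] {Z' : Ω → 𝓩'}
    {π : 𝓩' → 𝓩 × 𝓐 × 𝓨} (hA : Measurable aStar) (hR : Measurable R)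
    (hsub : ∀ θ a, HasSubgaussianMGF (fun y => R y - meanReward p R a θ) v (p (θ, a)))
    (hB : ∀ θ a, |meanReward p R a θ| ≤ B) (hθ : HasCondDistrib θs Z b P)
    (hact : HasCondDistrib A (fun ω => (θs ω, Z ω)) (Kernel.prodMkLeft Θ (b.map aStar)) P)
    (hout : HasCondDistrib Y (fun ω => (θs ω, Z ω, A ω))
      (p.comap (fun x : Θ × 𝓩 × 𝓐 => (x.1, x.2.2)) (by fun_prop)) P)
    (hstar : HasCondDistrib Ystar θs (optKernel p aStar hA) P)
    (hZ' : AEMeasurable Z' P) (hπ : Measurable π) (hπZ : ∀ ω, π (Z' ω) = (Z ω, A ω, Y ω))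
    {c : ℝ} (hc : 0 < c) (hvc : v + B ^ 2 ≤ c) (η : ℝ) :
    condEntropy (aStar ∘ θs) Z' P ≤ condEntropy (aStar ∘ θs) Z P
      - η * ∫ ω, (R (Ystar ω) - R (Y ω)) ∂P + Fintype.card 𝓐 * (η ^ 2 * c / 2) := by
  classical
  have : IsMarkovKernel (b.map aStar) := Kernel.IsMarkovKernel.map _ hA
  -- Probability matching: given the past, the optimal action has the same law as the action played.
  have hX : HasCondDistrib (aStar ∘ θs) Z (b.map aStar) P := hθ.comp_left hA
  have hX' := hasCondDistrib_condDistrib hZ' hX.aemeasurable_snd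
  obtain ⟨hi, he⟩ := integral_tiltScore hA hR hsub hB hθ hact hout hc
  obtain ⟨-, hreg⟩ := integral_regret_eq hA hR hsub hB hθ hact hout hstar
  have hZ := hθ.aemeasurable_fst
  have hscore : ∀ a', Measurable fun x : 𝓩 × 𝓐 × 𝓨 =>
      tiltScore p R b aStar c a' x.1 x.2.1 x.2.2 := by
    intro a'
    have hj : ∀ f : 𝓐 → 𝓩 → ℝ, (∀ a, Measurable (f a)) →
        Measurable fun x : 𝓩 × 𝓐 × 𝓨 => f x.2.1 x.1 := fun f hf =>
      (measurable_prod_of_forall_discrete (f := fun x : 𝓩 × 𝓐 => f x.2 x.1) hf).comp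
        (by fun_prop : Measurable fun x : 𝓩 × 𝓐 × 𝓨 => (x.1, x.2.1))
    have h1 := hj _ fun a => measurable_tiltSlope (p := p) (b := b) hR hA c a
    have h2 := hj _ fun a => measurable_posteriorMean (p := p) (b := b) hR a
    exact Measurable.ite ((by fun_prop : Measurable fun x : 𝓩 × 𝓐 × 𝓨 => x.2.1)
      (measurableSet_singleton a')) (by fun_prop) measurable_const
  have hq := fun a => measurable_actionProb (b := b) hA a
  -- The trial law: the old posterior of the optimal action times the exponential tilt. For fixed
  -- data its sum over `a'` may exceed `1`; only its average is controlled, in `hsum`.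
  let r : 𝓩 × 𝓐 × 𝓨 → 𝓐 → ℝ := fun x a' =>
    actionProb b aStar a' x.1 * Real.exp (tiltScore p R b aStar c a' x.1 x.2.1 x.2.2)
  have hr : ∀ a', Measurable fun x => r x a' := fun a' =>
    ((hq a').comp measurable_fst).mul (Real.measurable_exp.comp (hscore a'))
  have hpos : ∀ᵐ ω ∂P, 0 < actionProb b aStar (aStar (θs ω)) (Z ω) := by
    filter_upwards [HasCondDistrib.ae_pos hX] with ω hω
    rwa [map_real_singleton hA] at hω
  have hlogq := HasCondDistrib.integrable_log hX
  simp only [map_real_singleton hA, Function.comp_apply] at hlogq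
  have hlogr : (fun ω => Real.log (r (Z ω, A ω, Y ω) (aStar (θs ω)))) =ᵐ[P]
      fun ω => Real.log (actionProb b aStar (aStar (θs ω)) (Z ω)) +
        tiltScore p R b aStar c (aStar (θs ω)) (Z ω) (A ω) (Y ω) := by
    filter_upwards [hpos] with ω hω
    rw [Real.log_mul hω.ne' (Real.exp_pos _).ne', Real.log_exp]
  have hsum : ∑ a', ∫⁻ ω, ENNReal.ofReal (r (Z ω, A ω, Y ω) a') ∂P ≤ 1 := by
    calc _ ≤ ∑ a', ∫⁻ ω, ENNReal.ofReal (actionProb b aStar a' (Z ω)) ∂P := by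
          refine Finset.sum_le_sum fun a' _ => ?_
          refine lintegral_le_of_forall_action hA hθ hact hout
            (F := fun x => ENNReal.ofReal (r x a')) (hr a').ennreal_ofReal
            (W := fun z => ENNReal.ofReal (actionProb b aStar a' z)) fun z a => ?_
          have h0 : 0 ≤ actionProb b aStar a' z := measureReal_nonneg
          simp only [r, ENNReal.ofReal_mul h0]
          simp_rw [lintegral_const_mul' _ _ ENNReal.ofReal_ne_top]
          exact mul_le_of_le_one_right' (lintegral_exp_tiltScore_le hR hsub hB hvc a' a z)
      _ = 1 := by
          have hm : ∀ a ∈ Finset.univ,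
              AEMeasurable (fun ω => ENNReal.ofReal (actionProb b aStar a (Z ω))) P :=
            fun a _ => (hq a).ennreal_ofReal.comp_aemeasurable hZ
          rw [← lintegral_finsetSum' _ hm]
          simp_rw [← map_real_singleton hA, sum_ofReal_measureReal_singleton]
          simp
  have gibbs := HasCondDistrib.integral_log_le hX' (r := fun z' a' => r (π z') a')
    (fun a' => (hr a').comp hπ) (fun z' a' => mul_nonneg measureReal_nonneg (Real.exp_pos _).le)
    (by
      filter_upwards [hpos] with ω hω
      simp only [hπZ]
      exact mul_pos hω (Real.exp_pos _))
    (by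
      simp only [hπZ]
      exact (hlogq.add hi).congr hlogr.symm)
    (by simpa only [hπZ] using hsum)
  simp only [hπZ, Function.comp_apply] at gibbs
  rw [integral_congr_ae hlogr, integral_add hlogq hi, he] at gibbs
  rw [HasCondDistrib.condEntropy_eq hX, HasCondDistrib.condEntropy_eq hX', hreg]
  simp only [map_real_singleton hA, Function.comp_apply]
  have hg1 : Integrable (fun ω => ∑ a, actionGap p R b aStar a (Z ω)) P :=
    integrable_finsetSum _ fun a _ => by simpa using integrable_actionGap_pow hR hA hB hZ a 1
  have hg2 : Integrable (fun ω => ∑ a, actionGap p R b aStar a (Z ω) ^ 2 / (2 * c)) P :=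
    integrable_finsetSum _ fun a _ => (integrable_actionGap_pow hR hA hB hZ a 2).div_const _
  have hgap : η * ∫ ω, ∑ a, actionGap p R b aStar a (Z ω) ∂P - Fintype.card 𝓐 * (η ^ 2 * c / 2)
      ≤ ∫ ω, ∑ a, actionGap p R b aStar a (Z ω) ^ 2 / (2 * c) ∂P := by
    have : ∫ ω, (η * ∑ a, actionGap p R b aStar a (Z ω) - Fintype.card 𝓐 * (η ^ 2 * c / 2)) ∂P =
        η * ∫ ω, ∑ a, actionGap p R b aStar a (Z ω) ∂P - Fintype.card 𝓐 * (η ^ 2 * c / 2) := by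
      rw [integral_sub (hg1.const_mul η) (integrable_const _), integral_const_mul]
      simp
    rw [← this]
    refine integral_mono ((hg1.const_mul η).sub (integrable_const _)) hg2 fun ω => ?_
    simp only
    rw [← nsmul_eq_mul, ← Finset.card_univ, ← Finset.sum_const, Finset.mul_sum,
      ← Finset.sum_sub_distrib]
    refine Finset.sum_le_sum fun a _ => ?_
    rw [le_div_iff₀ (by positivity)]
    -- Expanding `(g - η * c) ^ 2 ≥ 0` gives `g ^ 2 / (2 * c) ≥ η * g - η ^ 2 * c / 2`.
    nlinarith [sq_nonneg (actionGap p R b aStar a (Z ω) - η * c)]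
  linarith

end RoundBound

/-! ### Summation over the rounds and choice of the trade-off. -/

section Regret

set_option linter.unusedSectionVars false

variable {Ω Θ 𝓐 𝓨 : Type*} [MeasurableSpace Ω] [MeasurableSpace Θ] [StandardBorelSpace Θ]
  [Nonempty Θ] [MeasurableSpace 𝓐] [MeasurableSpace 𝓨]
  {p : Kernel (Θ × 𝓐) 𝓨} [IsMarkovKernel p] {aStar : Θ → 𝓐} {hA : Measurable aStar}
  {P₀ : Measure Θ} {N : ℕ} {P : Measure Ω} [IsProbabilityMeasure P]
  {θs : Ω → Θ} {D : Ω → Fin N → 𝓨} {θhat : ℕ → Ω → Θ} {A : ℕ → Ω → 𝓐} {Y Ystar : ℕ → Ω → 𝓨}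

namespace IsExpertThompsonSampling

lemma aemeasurable_data (h : IsExpertThompsonSampling p aStar hA P₀ N P θs D θhat A Y Ystar)
    (t : ℕ) : AEMeasurable (fun ω => (D ω, history A Y t ω)) P :=
  (h.sample_law t).aemeasurable_fst.snd

lemma hasCondDistrib_belief
    (h : IsExpertThompsonSampling p aStar hA P₀ N P θs D θhat A Y Ystar) (t : ℕ) :
    HasCondDistrib θs (fun ω => (D ω, history A Y t ω)) (belief P θs D A Y t) P :=
  hasCondDistrib_condDistrib (h.aemeasurable_data t) h.param_law.aemeasurable

instance (t : ℕ) : IsMarkovKernel (belief P θs D A Y t) := by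
  unfold belief; infer_instance

/-- Pushing the sampled parameter through `aStar` puts the action in the form the one-round bounds
need: its law depends on the data only, not on the true parameter. -/
lemma hasCondDistrib_action
    (h : IsExpertThompsonSampling p aStar hA P₀ N P θs D θhat A Y Ystar) (t : ℕ) :
    HasCondDistrib (A t) (fun ω => (θs ω, D ω, history A Y t ω))
      (Kernel.prodMkLeft Θ ((belief P θs D A Y t).map aStar)) P := by
  have hA' : A t = aStar ∘ θhat t := funext (h.action_eq t)
  have : IsMarkovKernel (sampleKernel P θs D A Y t) := by
    unfold sampleKernel; infer_instance
  have hk : Kernel.prodMkLeft Θ ((belief P θs D A Y t).map aStar) =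
      (sampleKernel P θs D A Y t).map aStar := by
    ext x : 1
    rw [Kernel.prodMkLeft_apply, Kernel.map_apply _ hA, Kernel.map_apply _ hA, sampleKernel,
      Kernel.comap_apply]
  rw [hk]
  have hs := (h.sample_law t).comp_left hA
  rwa [← hA'] at hs

lemma hasCondDistrib_outcome
    (h : IsExpertThompsonSampling p aStar hA P₀ N P θs D θhat A Y Ystar) (t : ℕ) :
    HasCondDistrib (Y t) (fun ω => (θs ω, (D ω, history A Y t ω), A t ω))
      (p.comap (fun x : Θ × ((Fin N → 𝓨) × (Fin t → 𝓐 × 𝓨)) × 𝓐 => (x.1, x.2.2))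
        (by fun_prop)) P := by
  let f : Θ × (Fin N → 𝓨) × (Fin t → 𝓐 × 𝓨) × 𝓐 →
      Θ × ((Fin N → 𝓨) × (Fin t → 𝓐 × 𝓨)) × 𝓐 := fun x => (x.1, (x.2.1, x.2.2.1), x.2.2.2)
  have hf : Measurable f := by fun_prop
  exact HasCondDistrib.comp_right (f := f) (hf := hf)
    (κ := p.comap (fun x : Θ × ((Fin N → 𝓨) × (Fin t → 𝓐 × 𝓨)) × 𝓐 => (x.1, x.2.2)) (by fun_prop))
    (h.outcome_law t)

variable [Fintype 𝓐] [Nonempty 𝓐] [DiscreteMeasurableSpace 𝓐] {R : 𝓨 → ℝ} {v : ℝ≥0} {B : ℝ}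

lemma integrable_regret (h : IsExpertThompsonSampling p aStar hA P₀ N P θs D θhat A Y Ystar)
    (hR : Measurable R)
    (hsub : ∀ θ a, HasSubgaussianMGF (fun y => R y - meanReward p R a θ) v (p (θ, a)))
    (hB : ∀ θ a, |meanReward p R a θ| ≤ B) (t : ℕ) :
    Integrable (fun ω => R (Ystar t ω) - R (Y t ω)) P :=
  (integral_regret_eq hA hR hsub hB (h.hasCondDistrib_belief t) (h.hasCondDistrib_action t)
    (h.hasCondDistrib_outcome t) (h.optimal_law t)).1

/-- The one-round bounds telescope. Keeping the same `η` in every round postpones the optimisation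
until after the sum, so no Cauchy–Schwarz step over the rounds is needed. -/
lemma condEntropy_le (h : IsExpertThompsonSampling p aStar hA P₀ N P θs D θhat A Y Ystar)
    (hR : Measurable R)
    (hsub : ∀ θ a, HasSubgaussianMGF (fun y => R y - meanReward p R a θ) v (p (θ, a)))
    (hB : ∀ θ a, |meanReward p R a θ| ≤ B) {c : ℝ} (hc : 0 < c) (hvc : v + B ^ 2 ≤ c) (η : ℝ)
    (T : ℕ) :
    condEntropy (aStar ∘ θs) (fun ω => (D ω, history A Y T ω)) P ≤ condEntropy (aStar ∘ θs) D P
      - η * ∑ t ∈ Finset.range T, ∫ ω, (R (Ystar t ω) - R (Y t ω)) ∂P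
      + T * (Fintype.card 𝓐 * (η ^ 2 * c / 2)) := by
  induction T with
  | zero =>
    -- The empty history adds nothing to `D`, but only one inequality is required, and it follows
    -- from monotonicity.
    simpa using condEntropy_le_of_comp (π := Prod.fst)
      (hA.comp_aemeasurable h.param_law.aemeasurable) (h.aemeasurable_data 0) measurable_fst
      (fun _ => rfl)
  | succ T ih =>
    have hstep := condEntropy_le_sub_regret
      -- Splits off the last round from a history of length `T + 1`.
      (π := fun z : (Fin N → 𝓨) × (Fin (T + 1) → 𝓐 × 𝓨) =>
        ((z.1, fun s : Fin T => z.2 s.castSucc), (z.2 (Fin.last T)).1, (z.2 (Fin.last T)).2))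
      hA hR hsub hB (h.hasCondDistrib_belief T) (h.hasCondDistrib_action T)
      (h.hasCondDistrib_outcome T) (h.optimal_law T) (h.aemeasurable_data (T + 1))
      (by fun_prop) (fun ω => rfl) hc hvc η
    rw [Finset.sum_range_succ]
    push_cast
    linarith

end IsExpertThompsonSampling

/-- Optimisation over the free parameter of a quadratic trade-off. -/
lemma le_sqrt_of_forall_mul_le {x H K : ℝ} (hK : 0 < K)
    (h : ∀ η : ℝ, η * x ≤ H + η ^ 2 * K) : x ≤ √(4 * K * H) := by
  refine Real.le_sqrt_of_sq_le ?_
  -- This `η` maximises `η * x - η ^ 2 * K`, with value `x ^ 2 / (4 * K)`.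
  have := h (x / (2 * K))
  field_simp at this
  nlinarith

end Regret

theorem theorem1
    {Θ 𝓐 𝓨 : Type*} [MeasurableSpace Θ] [StandardBorelSpace Θ] [Nonempty Θ]
    [Fintype 𝓐] [Nonempty 𝓐] [MeasurableSpace 𝓐] [DiscreteMeasurableSpace 𝓐]
    [MeasurableSpace 𝓨]
    (p : Kernel (Θ × 𝓐) 𝓨) [IsMarkovKernel p] (R : 𝓨 → ℝ) (hR : Measurable R)
    (v : ℝ≥0) (B : ℝ)
    (hsub : ∀ θ a, HasSubgaussianMGF (fun y => R y - meanReward p R a θ) v (p (θ, a)))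
    (hB : ∀ θ a, |meanReward p R a θ| ≤ B)
    (aStar : Θ → 𝓐) (hA : Measurable aStar)
    (hopt : ∀ θ a, meanReward p R a θ ≤ meanReward p R (aStar θ) θ) :
    ∃ C : ℝ, ∀ (P₀ : Measure Θ) [IsProbabilityMeasure P₀] (N T : ℕ)
      {Ω : Type*} [MeasurableSpace Ω] (P : Measure Ω) [IsProbabilityMeasure P]
      (θs : Ω → Θ) (D : Ω → Fin N → 𝓨) (θhat : ℕ → Ω → Θ) (A : ℕ → Ω → 𝓐)
      (Y Ystar : ℕ → Ω → 𝓨),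
      IsExpertThompsonSampling p aStar hA P₀ N P θs D θhat A Y Ystar →
        0 ≤ mutualInfo (aStar ∘ θs) D P ∧
        mutualInfo (aStar ∘ θs) D P ≤ entropy (aStar ∘ θs) P ∧
        Integrable (regret R Y Ystar T) P ∧
        ∫ ω, regret R Y Ystar T ω ∂P ≤
          C * √(T * (entropy (aStar ∘ θs) P - mutualInfo (aStar ∘ θs) D P)) := by
  -- The summand `1` keeps the sub-Gaussian parameter positive when `v` and `B` both vanish.
  have hc : (0 : ℝ) < v + B ^ 2 + 1 := by positivity
  set c : ℝ := v + B ^ 2 + 1 with hcdef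
  -- With `K = T * (card 𝓐 * (c / 2))`, the bound `√(4 * K * H)` is `√(2 * card 𝓐 * c) * √(T * H)`.
  refine ⟨√(2 * Fintype.card 𝓐 * c), ?_⟩
  intro P₀ _ N T Ω _ P _ θs D θhat A Y Ystar h
  have hX : AEMeasurable (aStar ∘ θs) P := hA.comp_aemeasurable h.param_law.aemeasurable
  have hD : AEMeasurable D P := h.expert_law.aemeasurable_snd
  have hint := fun t => h.integrable_regret hR hsub hB t
  refine ⟨sub_nonneg.2 (condEntropy_le_entropy hX hD),
    sub_le_self _ (condEntropy_nonneg _ _ _), integrable_finsetSum _ fun t _ => hint t, ?_⟩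
  rw [mutualInfo, sub_sub_cancel, ← Real.sqrt_mul (by positivity)]
  simp only [regret]
  rw [integral_finsetSum _ fun t _ => hint t]
  -- The optimisation needs `K > 0`, hence `T > 0`; for `T = 0` the regret is an empty sum.
  rcases T.eq_zero_or_pos with rfl | hT
  · simp
  have hcard : (0 : ℝ) < Fintype.card 𝓐 := by exact_mod_cast Fintype.card_pos
  have hT' : (0 : ℝ) < T := by exact_mod_cast hT
  have hle := le_sqrt_of_forall_mul_le (H := condEntropy (aStar ∘ θs) D P)
    (K := T * (Fintype.card 𝓐 * (c / 2))) (by positivity)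
    (x := ∑ t ∈ Finset.range T, ∫ ω, (R (Ystar t ω) - R (Y t ω)) ∂P) fun η => by
      have h1 := h.condEntropy_le hR hsub hB hc (by rw [hcdef]; linarith) η T
      have h2 := condEntropy_nonneg (aStar ∘ θs) (fun ω => (D ω, history A Y T ω)) P
      linarith
  refine hle.trans (le_of_eq ?_)
  congr 1
  ring
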